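/- Let $\ell\ge 2$ be a constant. For positive integers $N, M, N_0$ let $H:[M]\to[N]$ and $G:[M]^\ell\to[N_0]$ be independent uniformly random functions (oracles), where $[n]=\{0,\dots,n-1\}$, and let a target $y\in[N]$ be drawn from an arbitrary distribution $\mathcal D$, independently of $H$ and $G$. In the $\ell$-Nested Collision Finding problem an algorithm that is given $y$ and oracle access to $H$ and $G$ has to output two different tuples $(x_1,\dots,x_\ell)\ne(x'_1,\dots,x'_\ell)$ in $[M]^\ell$ with $x_1<\dots<x_\ell$, $x'_1<\dots<x'_\ell$, $\sum_i H(x_i)\equiv\sum_i H(x'_i)\equiv y \pmod N$ and $G(x_1,\dots,x_\ell)=G(x'_1,\dots,x'_\ell)$. A classical algorithm with space $S$ and $T$ queries makes $T$ queries in total to $H$ and $G$ and carries only $S$ bits of memory from one query to the next; its output is a function of its final memory. The computation between queries is unrestricted and may depend on the time step, on the target $y$ and on random coins, which are not counted as space. For all constants $p,a,b>0$ there are a constant $C>0$ and an integer $N_1$, depending only on $\ell,p,a,b$, such that the following holds for all $N\ge N_1$, all $M$ and $N_0\geq 1$ (in particular for $M$, $N_0$ polynomial in $N$), all $\mathcal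 D$, all $T$, and all $S$ with $a\log N\le S\le b\,N^{1/(\ell^2-1)}$: every classical algorithm with space $S$ and $T$ queries that solves the $\ell$-Nested Collision Finding problem with probability at least $p$ satisfies $$S^{\frac{\ell^2-1}{\ell}}\,T\ \ge\ C\,N^{\frac1\ell}N_0^{\frac12} \qquad\text{and}\qquad S^{\frac{\ell^2-1}{2\ell}}\,T\ \ge\ C\,N^{\frac1{2\ell}}N_0^{\frac12}.$$ -/

import Mathlib

namespace NestedCollision

/-- A tuple `(x₁, …, x_ℓ) ∈ [M]^ℓ` is valid if `x₁ < x₂ < ⋯ < x_ℓ`. -/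
def IsValidTuple {ℓ M : ℕ} (x : Fin ℓ → Fin M) : Prop :=
  StrictMono x

/-- `(x, x')` is a nested collision for the oracles `H : [M] → [N]`, `G : [M]^ℓ → [N₀]` and the
target `y`. The range `[N]` with addition modulo `N` is `ZMod N`. -/
structure IsNestedCollision {ℓ M N N₀ : ℕ} (H : Fin M → ZMod N)
    (G : (Fin ℓ → Fin M) → Fin N₀) (y : ZMod N) (x x' : Fin ℓ → Fin M) : Prop where
  ne : x ≠ x'
  valid_left : IsValidTuple x
  valid_right : IsValidTuple x'
  sum_left : ∑ i, H (x i) = y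
  sum_right : ∑ i, H (x' i) = y
  collision : G x = G x'

/-- A single oracle query: either a point of `[M]`, sent to `H`, or a tuple of `[M]^ℓ`, sent
to `G`. -/
inductive Query (ℓ M : ℕ) : Type
  | toH (x : Fin M) : Query ℓ M
  | toG (x : Fin ℓ → Fin M) : Query ℓ M

/-- The answer to a query: an element of `[N]` (from `H`) or of `[N₀]` (from `G`). -/
def answer {ℓ M N N₀ : ℕ} (H : Fin M → ZMod N) (G : (Fin ℓ → Fin M) → Fin N₀) :
    Query ℓ M → ZMod N ⊕ Fin N₀
  | .toH x => .inl (H x)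
  | .toG x => .inr (G x)

/-- A memory configuration of `S` bits. -/
abbrev Memory (S : ℕ) : Type := Fin S → Bool

/-- A deterministic query algorithm with `S` bits of space and `T` oracle queries to `H` or `G`
in total. Only the `S`-bit memory is carried from one query to the next; the computation between
queries is unrestricted and may depend on the time step. The output is computed from the final
content of the memory. -/
structure Program (ℓ M N N₀ S T : ℕ) : Type where
  init : Memory S
  query : Fin T → Memory S → Query ℓ M
  update : Fin T → Memory S → ZMod N ⊕ Fin N₀ → Memory S
  output : Memory S → (Fin ℓ → Fin M) × (Fin ℓ → Fin M)

/-- The content of the memory after the first `t` queries (it stays constant from time `T` on). -/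
def Program.memoryAt {ℓ M N N₀ S T : ℕ} (P : Program ℓ M N N₀ S T) (H : Fin M → ZMod N)
    (G : (Fin ℓ → Fin M) → Fin N₀) : ℕ → Memory S
  | 0 => P.init
  | t + 1 =>
    if h : t < T then
      P.update ⟨t, h⟩ (P.memoryAt H G t) (answer H G (P.query ⟨t, h⟩ (P.memoryAt H G t)))
    else P.memoryAt H G t

/-- The pair of tuples that the program outputs after its `T` queries. -/
def Program.result {ℓ M N N₀ S T : ℕ} (P : Program ℓ M N N₀ S T) (H : Fin M → ZMod N)
    (G : (Fin ℓ → Fin M) → Fin N₀) : (Fin ℓ → Fin M) × (Fin ℓ → Fin M) :=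
  P.output (P.memoryAt H G T)

/-- A (randomized) classical algorithm with `S` bits of space and `T` oracle queries: given the
target `y`, it runs a random program. Thus the target and the random coins may be read at any
time, and they do not count as space. -/
abbrev ClassicalAlgorithm (ℓ M N N₀ S T : ℕ) : Type :=
  ZMod N → PMF (Program ℓ M N N₀ S T)

/-- Sample a target `y` from `D`, the coins of the algorithm, and independent uniformly random
oracles `H` and `G`; the outcome is whether the output of the algorithm is a nested collision. -/
noncomputable def experiment {ℓ M N N₀ S T : ℕ} [NeZero N] [NeZero N₀]
    (D : PMF (ZMod N)) (A : ClassicalAlgorithm ℓ M N N₀ S T) : PMF Prop :=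
  D.bind fun y =>
  (A y).bind fun P =>
  (PMF.uniformOfFintype (Fin M → ZMod N)).bind fun H =>
  (PMF.uniformOfFintype ((Fin ℓ → Fin M) → Fin N₀)).bind fun G =>
  PMF.pure (IsNestedCollision H G y (P.result H G).1 (P.result H G).2)

/-- The probability that the algorithm solves the `ℓ`-Nested Collision Finding problem with
target distribution `D`. -/
noncomputable def successProbability {ℓ M N N₀ S T : ℕ} [NeZero N] [NeZero N₀]
    (D : PMF (ZMod N)) (A : ClassicalAlgorithm ℓ M N N₀ S T) : ℝ :=
  (experiment D A True).toReal

end NestedCollision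

/-!
# A time-space tradeoff for nested collision finding

Fix a target `y` and a deterministic program, and count the two output tuples as two further queries
to `G`. Call a valid tuple useful if its `H`-values sum to `y`. A nested collision is a collision of
`G` between two useful tuples that are queried, and `G` is independent of `H`, so `Ω(√N₀)` useful
tuples have to be queried in expectation (`Program.card_isNestedCollision_mul_le`,
`le_of_le_successProbability`).

For fixed `G`, a segment of `w` queries that starts with a fixed memory content is an adaptive
procedure that evaluates `H` at no more than `n = ℓ w` points, and the answers at fresh points
behave like independent uniform variables (`Adaptive.card_hasFreshSum_mul_le`). Hence the expected
number of useful tuples is at most `n ^ ℓ / N`, and the probability that `r` disjoint sets of `m` of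
these points, for some `m` between `1` and `ℓ`, have the same sum is at most
`ℓ N (n ^ ℓ / N) ^ r / r!` (`Adaptive.card_crowded_mul_le`). If this does not happen, then there are
at most `ℓ! r ^ ℓ` useful tuples, since a maximal disjoint family of solutions is small and meets
all others (`card_powersetCard_filter_sum_eq_le`).

With `n ^ ℓ` of order `N S` and `r` a large multiple of `S`, the failure probability is small enough
for a union bound over the `2 ^ S` memory contents at the start of a segment. So every segment
of length about `(N S) ^ (1 / ℓ)` contributes `O(S ^ ℓ)` useful tuples in expectation, whatever
happened before (`Program.sum_card_usefulBefore_le`), and comparing with `Ω(√N₀)` bounds the number of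
segments from below. Fewer queries than one such segment are covered by the bound `n ^ ℓ / N`
(`exists_tradeoff`). The second inequality of the theorem follows from the first one and the upper
bound on `S`. Only expectations are summed over the segments, so there is no union bound over
time and no restriction on `N₀`.
-/

namespace NestedCollision

open Finset Function

/-! ### Resampling one value of a random function -/

/-- If a point `φ F`, a prescribed value `f F` and a set `A` of functions are all insensitive to the
value of `F` at `φ F`, then a uniformly random `F ∈ A` takes the prescribed value with probability
at most `1 / |Y|`. -/
theorem card_filter_apply_eq_mul_card_le {X Y : Type*} [Fintype X] [DecidableEq X] [Fintype Y]
    [DecidableEq Y] (A : Finset (X → Y)) (φ : (X → Y) → X) (f : (X → Y) → Y)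
    (h : ∀ F ∈ A, ∀ v, update F (φ F) v ∈ A ∧ φ (update F (φ F) v) = φ F ∧
      f (update F (φ F) v) = f F) :
    #{F ∈ A | F (φ F) = f F} * Fintype.card Y ≤ #A := by
  rw [← card_univ, ← card_product]
  refine card_le_card_of_injOn (fun q => update q.1 (φ q.1) q.2) ?_ ?_
  · rintro ⟨F, v⟩ hF
    simp only [coe_product, Set.mem_prod, mem_coe, mem_filter] at hF
    exact (h F hF.1.1 v).1
  · rintro ⟨F, v⟩ hF ⟨F', v'⟩ hF' heq
    simp only [coe_product, Set.mem_prod, mem_coe, mem_filter] at hF hF' heq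
    obtain ⟨-, h1, h2⟩ := h F hF.1.1 v
    obtain ⟨-, h1', h2'⟩ := h F' hF'.1.1 v'
    have hφ : φ F = φ F' := by rw [← h1, heq, h1']
    have hf : f F = f F' := by rw [← h2, heq, h2']
    have hv : v = v' := by
      have := congrFun heq (φ F)
      rwa [update_self, hφ, update_self] at this
    have hFF : F = F' := by
      funext x
      by_cases hx : x = φ F
      · rw [hx, hF.1.2, hf, ← hF'.1.2, hφ]
      · have := congrFun heq x
        rwa [update_of_ne hx, update_of_ne (hφ ▸ hx)] at this
    rw [hFF, hv]

/-! ### Adaptive query sequences -/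

/-- A query sequence to an oracle `H` is adaptive if the query at time `t` depends only on the
answers to the queries made before time `t`. -/
def Adaptive {X Y : Type*} (q : (X → Y) → ℕ → X) : Prop :=
  ∀ H H' t, (∀ s < t, H' (q H s) = H (q H s)) → q H' t = q H t

/-- The query at time `t` has not been made before. -/
def Fresh {X Y : Type*} (q : (X → Y) → ℕ → X) (H : X → Y) (t : ℕ) : Prop :=
  ∀ s < t, q H s ≠ q H t

theorem Adaptive.update_eq {X Y : Type*} [DecidableEq X] {q : (X → Y) → ℕ → X} (hq : Adaptive q)
    {H : X → Y} {t : ℕ} (ht : Fresh q H t) (v : Y) {s : ℕ} (hs : s ≤ t) :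
    q (update H (q H t) v) s = q H s :=
  hq H _ s fun u hu => update_of_ne (ht u (hu.trans_le hs)) _ _

theorem Adaptive.fresh_update {X Y : Type*} [DecidableEq X] {q : (X → Y) → ℕ → X} (hq : Adaptive q)
    {H : X → Y} {t : ℕ} (ht : Fresh q H t) (v : Y) {s : ℕ} (hs : s ≤ t) (h : Fresh q H s) :
    Fresh q (update H (q H t) v) s := by
  intro u hu
  rw [hq.update_eq ht v hs, hq.update_eq ht v (hu.le.trans hs)]
  exact h u hu

/-- All times in `I` are fresh, and the answers obtained at these times sum to `z`. -/
def HasFreshSum {X Y : Type*} [AddCommMonoid Y] (q : (X → Y) → ℕ → X) (z : Y) (H : X → Y)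
    (I : Finset ℕ) : Prop :=
  (∀ i ∈ I, Fresh q H i) ∧ ∑ i ∈ I, H (q H i) = z

theorem HasFreshSum.update {X Y : Type*} [DecidableEq X] [AddCommMonoid Y]
    {q : (X → Y) → ℕ → X} (hq : Adaptive q) {z : Y} {H : X → Y} {I : Finset ℕ}
    (hI : HasFreshSum q z H I) {t : ℕ} (ht : Fresh q H t) (v : Y) (hlt : ∀ i ∈ I, i < t) :
    HasFreshSum q z (update H (q H t) v) I := by
  refine ⟨fun i hi => hq.fresh_update ht v (hlt i hi).le (hI.1 i hi), ?_⟩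
  rw [← hI.2]
  refine sum_congr rfl fun i hi => ?_
  rw [hq.update_eq ht v (hlt i hi).le, update_of_ne (ht i (hlt i hi))]

open scoped Classical in
/-- The answers at fresh times behave like independent uniform variables: for `r` disjoint sets of
times, each of them has fresh sum `z` with probability at most `|Y| ^ (-r)`. The set containing the
latest time is removed, and the answer at this time is resampled. -/
theorem Adaptive.card_hasFreshSum_mul_le {X Y : Type*} [Fintype X] [DecidableEq X] [Fintype Y]
    [AddCommGroup Y]
    {q : (X → Y) → ℕ → X} (hq : Adaptive q) (z : Y) (𝓕 : Finset (Finset ℕ))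
    (hne : ∀ I ∈ 𝓕, I.Nonempty) (hdisj : (𝓕 : Set (Finset ℕ)).PairwiseDisjoint id) :
    #{H : X → Y | ∀ I ∈ 𝓕, HasFreshSum q z H I} * Fintype.card Y ^ #𝓕 ≤
      Fintype.card (X → Y) := by
  induction 𝓕 using Finset.induction_on_max_value (fun I : Finset ℕ => I.sup id) with
  | empty => simp
  | insert I 𝓕 hI hmax ih =>
    have ih' := ih (fun J hJ => hne J (mem_insert_of_mem hJ))
      (hdisj.subset (by simp))
    obtain ⟨t, htI, ht⟩ := exists_mem_eq_sup I (hne I (mem_insert_self _ _)) id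
    simp only [id] at ht
    have hleI : ∀ i ∈ I, i ≤ t := fun i hi => ht ▸ le_sup (f := id) hi
    have hlt : ∀ J ∈ 𝓕, ∀ i ∈ J, i < t := by
      intro J hJ i hi
      refine lt_of_le_of_ne ((le_sup (f := id) hi).trans ((hmax J hJ).trans ht.le)) ?_
      rintro rfl
      have hd := hdisj (mem_coe.2 (mem_insert_of_mem hJ)) (mem_coe.2 (mem_insert_self I 𝓕))
        (by rintro rfl; exact hI hJ)
      exact disjoint_left.1 hd hi htI
    set A : Finset (X → Y) :=
      {H | (∀ J ∈ 𝓕, HasFreshSum q z H J) ∧ ∀ i ∈ I, Fresh q H i} with hA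
    have key := card_filter_apply_eq_mul_card_le A (fun H => q H t)
      (fun H => z - ∑ i ∈ I.erase t, H (q H i)) (by
        intro H hH v
        simp only [hA, mem_filter, mem_univ, true_and] at hH ⊢
        have hft := hH.2 t htI
        refine ⟨⟨fun J hJ => (hH.1 J hJ).update hq hft v (hlt J hJ),
          fun i hi => hq.fresh_update hft v (hleI i hi) (hH.2 i hi)⟩,
          hq.update_eq hft v le_rfl, ?_⟩
        congr 1
        refine sum_congr rfl fun i hi => ?_
        have hit : i < t := lt_of_le_of_ne (hleI i (mem_of_mem_erase hi)) (ne_of_mem_erase hi)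
        rw [hq.update_eq hft v hit.le, update_of_ne (hft i hit)])
    have hsub : ({H | ∀ J ∈ insert I 𝓕, HasFreshSum q z H J} : Finset (X → Y)) ⊆
        {H ∈ A | H (q H t) = z - ∑ i ∈ I.erase t, H (q H i)} := by
      intro H hH
      simp only [hA, mem_filter, mem_univ, true_and, mem_insert, forall_eq_or_imp] at hH ⊢
      refine ⟨⟨hH.2, hH.1.1⟩, ?_⟩
      rw [eq_sub_iff_add_eq, add_sum_erase I (fun i => H (q H i)) htI, hH.1.2]
    have hA' : #A ≤ #{H : X → Y | ∀ J ∈ 𝓕, HasFreshSum q z H J} :=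
      card_le_card fun H hH => by
        simp only [hA, mem_filter, mem_univ, true_and] at hH ⊢
        exact hH.1
    rw [card_insert_of_notMem hI, pow_succ']
    calc _ ≤ #{H ∈ A | H (q H t) = z - ∑ i ∈ I.erase t, H (q H i)} *
          (Fintype.card Y * Fintype.card Y ^ #𝓕) := Nat.mul_le_mul_right _ (card_le_card hsub)
      _ = #{H ∈ A | H (q H t) = z - ∑ i ∈ I.erase t, H (q H i)} * Fintype.card Y *
          Fintype.card Y ^ #𝓕 := by ring
      _ ≤ #{H : X → Y | ∀ J ∈ 𝓕, HasFreshSum q z H J} * Fintype.card Y ^ #𝓕 :=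
          Nat.mul_le_mul_right _ (key.trans hA')
      _ ≤ _ := ih'

/-! ### Many subsets with equal sum contain many disjoint ones -/

/-- If, for every `m` between `1` and `ℓ`, any pairwise disjoint family of `m`-subsets of `Z` with
equal weight has at most `r` members, then at most `ℓ! r ^ ℓ` subsets of size `ℓ` have weight `y`:
each of them meets the at most `ℓ r` points of a maximal disjoint family, and removing such a
point leaves an `(ℓ - 1)`-subset of prescribed weight. -/
theorem card_powersetCard_filter_sum_eq_le {α Y : Type*} [DecidableEq α] [AddCommGroup Y]
    [DecidableEq Y] (Z : Finset α) (w : α → Y) (r ℓ : ℕ)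
    (h : ∀ m, 1 ≤ m → m ≤ ℓ → ∀ z, ∀ 𝓕 ⊆ {B ∈ Z.powersetCard m | ∑ i ∈ B, w i = z},
      (𝓕 : Set (Finset α)).PairwiseDisjoint id → #𝓕 ≤ r) (y : Y) :
    #{B ∈ Z.powersetCard ℓ | ∑ i ∈ B, w i = y} ≤ ℓ.factorial * r ^ ℓ := by
  induction ℓ generalizing y with
  | zero => exact (card_filter_le _ _).trans (by simp)
  | succ ℓ ih =>
    replace ih := ih fun m h1 h2 => h m h1 (h2.trans ℓ.le_succ)
    set 𝓢 := {B ∈ Z.powersetCard (ℓ + 1) | ∑ i ∈ B, w i = y} with h𝓢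
    classical
    obtain ⟨𝓕, h𝓕, hmax⟩ := exists_max_image
      (𝓢.powerset.filter fun 𝓕 : Finset (Finset α) => (𝓕 : Set (Finset α)).PairwiseDisjoint id)
      card ⟨∅, by simp⟩
    simp only [mem_filter, mem_powerset] at h𝓕 hmax
    have hr := h (ℓ + 1) (by omega) le_rfl y 𝓕 h𝓕.1 h𝓕.2
    set D := 𝓕.biUnion id with hD
    have hDcard : #D ≤ r * (ℓ + 1) := by
      refine card_biUnion_le.trans ((sum_le_card_nsmul _ _ (ℓ + 1) fun B hB => ?_).trans ?_)
      · exact (mem_powersetCard.1 (mem_filter.1 (h𝓕.1 hB)).1).2.le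
      · exact Nat.mul_le_mul_right _ hr
    have hmeet : ∀ B ∈ 𝓢, ∃ x ∈ D, x ∈ B := by
      intro B hB
      by_contra! hcon
      have hBd : ∀ C ∈ 𝓕, Disjoint B C := fun C hC =>
        disjoint_right.2 fun x hx => hcon x (mem_biUnion.2 ⟨C, hC, hx⟩)
      have hBne : B.Nonempty := by
        rw [← card_pos, (mem_powersetCard.1 (mem_filter.1 hB).1).2]
        omega
      have hB𝓕 : B ∉ 𝓕 := fun hmem => hBne.ne_empty (disjoint_self.1 (hBd B hmem))
      have := hmax (insert B 𝓕) ⟨insert_subset hB h𝓕.1, by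
        rw [coe_insert]
        exact h𝓕.2.insert fun C hC _ => hBd C hC⟩
      rw [card_insert_of_notMem hB𝓕] at this
      omega
    have hsub : 𝓢 ⊆ D.biUnion fun x => {B ∈ 𝓢 | x ∈ B} := by
      intro B hB
      obtain ⟨x, hx, hxB⟩ := hmeet B hB
      exact mem_biUnion.2 ⟨x, hx, mem_filter.2 ⟨hB, hxB⟩⟩
    have hx : ∀ x ∈ D, #{B ∈ 𝓢 | x ∈ B} ≤ ℓ.factorial * r ^ ℓ := by
      intro x _
      refine le_trans (card_le_card_of_injOn (fun B => B.erase x) ?_ ?_) (ih (y - w x))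
      · intro B hB
        simp only [h𝓢, coe_filter, mem_filter, mem_powersetCard, Set.mem_ofPred_eq] at hB ⊢
        obtain ⟨⟨⟨hBZ, hBc⟩, hBs⟩, hxB⟩ := hB
        refine ⟨⟨(erase_subset _ _).trans hBZ, by rw [card_erase_of_mem hxB, hBc]; rfl⟩, ?_⟩
        rw [eq_sub_iff_add_eq, sum_erase_add _ _ hxB, hBs]
      · intro B hB B' hB' heq
        simp only [coe_filter, Set.mem_ofPred_eq] at hB hB' heq
        rw [← insert_erase hB.2, heq, insert_erase hB'.2]
    calc #𝓢 ≤ #D * (ℓ.factorial * r ^ ℓ) :=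
          (card_le_card hsub).trans (card_biUnion_le_card_mul _ _ _ hx)
      _ ≤ r * (ℓ + 1) * (ℓ.factorial * r ^ ℓ) := Nat.mul_le_mul_right _ hDcard
      _ = (ℓ + 1).factorial * r ^ (ℓ + 1) := by rw [Nat.factorial_succ]; ring

/-! ### Equal sums among adaptively queried values -/

theorem exists_fresh_eq {X Y : Type*} (q : (X → Y) → ℕ → X) (H : X → Y) (t : ℕ) :
    ∃ s ≤ t, Fresh q H s ∧ q H s = q H t := by
  induction t using Nat.strong_induction_on with
  | _ t ih =>
    by_cases ht : Fresh q H t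
    · exact ⟨t, le_rfl, ht, rfl⟩
    · simp only [Fresh, not_forall, not_not] at ht
      obtain ⟨s, hs, he⟩ := ht
      obtain ⟨u, hu, hf, he'⟩ := ih s hs
      exact ⟨u, hu.trans hs.le, hf, he'.trans he⟩

theorem Fresh.eq_of_eq {X Y : Type*} {q : (X → Y) → ℕ → X} {H : X → Y} {s t : ℕ}
    (hs : Fresh q H s) (ht : Fresh q H t) (h : q H s = q H t) : s = t := by
  rcases lt_trichotomy s t with hlt | heq | hgt
  · exact absurd h (ht s hlt)
  · exact heq
  · exact absurd h.symm (hs t hgt)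

open scoped Classical in
/-- A set of queried points is determined by the times at which its points were first queried. -/
theorem card_le_card_hasFreshSum {X Y : Type*} [AddCommMonoid Y] (q : (X → Y) → ℕ → X)
    (H : X → Y) (n ℓ : ℕ) (y : Y) (𝓡 : Finset (Finset X)) (hcard : ∀ R ∈ 𝓡, #R = ℓ)
    (hsum : ∀ R ∈ 𝓡, ∑ x ∈ R, H x = y) (hmem : ∀ R ∈ 𝓡, ∀ x ∈ R, ∃ t < n, q H t = x) :
    #𝓡 ≤ #{B ∈ (range n).powersetCard ℓ | HasFreshSum q y H B} := by
  set τ : Finset X → Finset ℕ := fun R => {t ∈ range n | Fresh q H t ∧ q H t ∈ R} with hτ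
  have hinj : ∀ R, Set.InjOn (q H) (τ R) := by
    intro R s hs t ht h
    simp only [hτ, coe_filter, Set.mem_ofPred_eq] at hs ht
    exact hs.2.1.eq_of_eq ht.2.1 h
  have himg : ∀ R ∈ 𝓡, (τ R).image (q H) = R := by
    intro R hR
    ext x
    simp only [hτ, mem_image, mem_filter, mem_range]
    constructor
    · rintro ⟨t, ht, rfl⟩
      exact ht.2.2
    · intro hx
      obtain ⟨t, ht, rfl⟩ := hmem R hR x hx
      obtain ⟨s, hs, hf, he⟩ := exists_fresh_eq q H t
      exact ⟨s, ⟨hs.trans_lt ht, hf, he ▸ hx⟩, he⟩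
  refine card_le_card_of_injOn τ ?_ ?_
  · intro R hR
    rw [mem_coe] at hR
    simp only [coe_filter, Set.mem_ofPred_eq, mem_powersetCard]
    refine ⟨⟨filter_subset _ _, ?_⟩, fun i hi => (mem_filter.1 hi).2.1, ?_⟩
    · rw [← card_image_of_injOn (hinj R), himg R hR, hcard R hR]
    · rw [← hsum R hR, ← himg R hR, sum_image (hinj R), himg R hR]
  · intro R hR R' hR' h
    rw [← himg R hR, h, himg R' hR']

open scoped Classical in
/-- The expected number of `ℓ`-subsets of the first `n` times with fresh sum `y` is at most
`n ^ ℓ / |Y|`. -/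
theorem Adaptive.sum_card_hasFreshSum_mul_le {X Y : Type*} [Fintype X] [DecidableEq X]
    [Fintype Y] [AddCommGroup Y] {q : (X → Y) → ℕ → X} (hq : Adaptive q) (n : ℕ)
    {ℓ : ℕ} (hℓ : 1 ≤ ℓ) (y : Y) :
    (∑ H : X → Y, #{B ∈ (range n).powersetCard ℓ | HasFreshSum q y H B}) * Fintype.card Y ≤
      n ^ ℓ * Fintype.card (X → Y) := by
  have hswap : ∑ H : X → Y, #{B ∈ (range n).powersetCard ℓ | HasFreshSum q y H B} =
      ∑ B ∈ (range n).powersetCard ℓ, #{H : X → Y | HasFreshSum q y H B} := by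
    simp only [card_filter]
    exact sum_comm
  rw [hswap, sum_mul]
  refine (sum_le_card_nsmul _ _ (Fintype.card (X → Y)) fun B hB => ?_).trans ?_
  · have hne : B.Nonempty := by
      rw [← card_pos, (mem_powersetCard.1 hB).2]
      omega
    simpa using hq.card_hasFreshSum_mul_le y {B} (by simpa using hne) (by simp)
  · rw [card_powersetCard, card_range, smul_eq_mul]
    exact Nat.mul_le_mul_right _ (Nat.choose_le_pow _ _)

/-- For some `m` between `1` and `ℓ`, there are `r` pairwise disjoint `m`-subsets of the first `n`
times that have the same fresh sum. -/
def Crowded {X Y : Type*} [AddCommMonoid Y] (q : (X → Y) → ℕ → X) (n r ℓ : ℕ) (H : X → Y) : Prop :=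
  ∃ m, 1 ≤ m ∧ m ≤ ℓ ∧ ∃ z, ∃ 𝓕 ∈ ((range n).powersetCard m).powersetCard r,
    (𝓕 : Set (Finset ℕ)).PairwiseDisjoint id ∧ ∀ I ∈ 𝓕, HasFreshSum q z H I

open scoped Classical in
theorem card_hasFreshSum_le_of_not_crowded {X Y : Type*} [AddCommGroup Y] {q : (X → Y) → ℕ → X}
    {n r ℓ : ℕ} {H : X → Y} (h : ¬ Crowded q n r ℓ H) (y : Y) :
    #{B ∈ (range n).powersetCard ℓ | HasFreshSum q y H B} ≤ ℓ.factorial * r ^ ℓ := by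
  refine le_trans (card_le_card ?_) (card_powersetCard_filter_sum_eq_le
    {t ∈ range n | Fresh q H t} (fun t => H (q H t)) r ℓ ?_ y)
  · intro B hB
    simp only [mem_filter, mem_powersetCard] at hB ⊢
    exact ⟨⟨fun t ht => mem_filter.2 ⟨hB.1.1 ht, hB.2.1 t ht⟩, hB.1.2⟩, hB.2.2⟩
  · intro m h1 h2 z 𝓕 h𝓕 hdisj
    by_contra! hlt
    obtain ⟨𝓖, h𝓖, hcard⟩ := exists_subset_card_eq hlt.le
    refine h ⟨m, h1, h2, z, 𝓖, mem_powersetCard.2 ⟨fun B hB => ?_, hcard⟩,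
      hdisj.subset (coe_subset.2 h𝓖), fun I hI => ?_⟩
    · have := h𝓕 (h𝓖 hB)
      simp only [mem_filter, mem_powersetCard] at this ⊢
      exact ⟨this.1.1.trans (filter_subset _ _), this.1.2⟩
    · have := h𝓕 (h𝓖 hI)
      simp only [mem_filter, mem_powersetCard] at this
      exact ⟨fun i hi => (mem_filter.1 (this.1.1 hi)).2, this.2⟩

open scoped Classical in
/-- Union bound over the size `m`, the common sum and the unordered family. -/
theorem Adaptive.card_crowded_mul_le {X Y : Type*} [Fintype X] [DecidableEq X]
    [Fintype Y] [AddCommGroup Y] {q : (X → Y) → ℕ → X} (hq : Adaptive q) (n r ℓ : ℕ) :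
    #{H : X → Y | Crowded q n r ℓ H} * Fintype.card Y ^ r ≤
      ℓ * Fintype.card Y * (n ^ ℓ).choose r * Fintype.card (X → Y) := by
  set 𝓐 : ℕ → Finset (Finset (Finset ℕ)) := fun m =>
    (((range n).powersetCard m).powersetCard r).filter
      fun 𝓕 : Finset (Finset ℕ) => (𝓕 : Set (Finset ℕ)).PairwiseDisjoint id with h𝓐
  have hsub : ({H | Crowded q n r ℓ H} : Finset (X → Y)) ⊆
      (Icc 1 ℓ).biUnion fun m => univ.biUnion fun z : Y => (𝓐 m).biUnion fun 𝓕 =>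
        {H | ∀ I ∈ 𝓕, HasFreshSum q z H I} := by
    intro H hH
    obtain ⟨m, h1, h2, z, 𝓕, h𝓕, hd, hI⟩ := (mem_filter.1 hH).2
    simp only [h𝓐, mem_biUnion, mem_filter, mem_univ, true_and, mem_Icc]
    exact ⟨m, ⟨h1, h2⟩, z, 𝓕, ⟨h𝓕, hd⟩, hI⟩
  have h𝓐card : ∀ m ∈ Icc 1 ℓ, #(𝓐 m) ≤ (n ^ ℓ).choose r := by
    intro m hm
    rw [mem_Icc] at hm
    refine (card_filter_le _ _).trans ?_
    rw [card_powersetCard, card_powersetCard, card_range]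
    refine Nat.choose_le_choose _ ((Nat.choose_le_pow _ _).trans ?_)
    rcases Nat.eq_zero_or_pos n with rfl | hn
    · rw [zero_pow (by omega), zero_pow (by omega)]
    · exact Nat.pow_le_pow_right hn hm.2
  have hone : ∀ m ∈ Icc 1 ℓ, ∀ z : Y, ∀ 𝓕 ∈ 𝓐 m,
      #{H : X → Y | ∀ I ∈ 𝓕, HasFreshSum q z H I} * Fintype.card Y ^ r ≤
        Fintype.card (X → Y) := by
    intro m hm z 𝓕 h𝓕
    simp only [h𝓐, mem_filter, mem_powersetCard] at h𝓕
    rw [← h𝓕.1.2]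
    refine hq.card_hasFreshSum_mul_le z 𝓕 (fun I hI => ?_) h𝓕.2
    rw [← card_pos, (mem_powersetCard.1 (h𝓕.1.1 hI)).2]
    exact (mem_Icc.1 hm).1
  calc #{H : X → Y | Crowded q n r ℓ H} * Fintype.card Y ^ r
      ≤ (∑ m ∈ Icc 1 ℓ, ∑ z : Y, ∑ 𝓕 ∈ 𝓐 m, #{H : X → Y | ∀ I ∈ 𝓕, HasFreshSum q z H I}) *
          Fintype.card Y ^ r := by
        refine Nat.mul_le_mul_right _ ((card_le_card hsub).trans (card_biUnion_le.trans ?_))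
        refine sum_le_sum fun m _ => card_biUnion_le.trans ?_
        exact sum_le_sum fun z _ => card_biUnion_le
    _ = ∑ m ∈ Icc 1 ℓ, ∑ z : Y, ∑ 𝓕 ∈ 𝓐 m,
          #{H : X → Y | ∀ I ∈ 𝓕, HasFreshSum q z H I} * Fintype.card Y ^ r := by
        simp only [sum_mul]
    _ ≤ ∑ m ∈ Icc 1 ℓ, ∑ _z : Y, (n ^ ℓ).choose r * Fintype.card (X → Y) := by
        refine sum_le_sum fun m hm => sum_le_sum fun z _ => ?_
        refine (sum_le_card_nsmul _ _ _ (hone m hm z)).trans ?_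
        exact Nat.mul_le_mul_right _ (h𝓐card m hm)
    _ = ℓ * Fintype.card Y * (n ^ ℓ).choose r * Fintype.card (X → Y) := by
        simp only [sum_const, Nat.card_Icc, card_univ, smul_eq_mul, Nat.add_sub_cancel]
        ring

/-! ### Runs of a program and the useful tuples it queries -/

/-- The query at time `t` with memory `m`, where the two output tuples count as queries to `G` at
the times `T` and `T + 1`. -/
def Program.access {ℓ M N N₀ S T : ℕ} (P : Program ℓ M N N₀ S T) (t : ℕ) (m : Memory S) :
    Query ℓ M :=
  if h : t < T then P.query ⟨t, h⟩ m
  else if t = T then .toG (P.output m).1 else .toG (P.output m).2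

/-- The memory at time `t + 1`, if it is `m` at time `t`. -/
def Program.step {ℓ M N N₀ S T : ℕ} (P : Program ℓ M N N₀ S T) (H : Fin M → ZMod N)
    (G : (Fin ℓ → Fin M) → Fin N₀) (t : ℕ) (m : Memory S) : Memory S :=
  if h : t < T then P.update ⟨t, h⟩ m (answer H G (P.query ⟨t, h⟩ m)) else m

/-- The memory at time `t₀ + s`, if it is `m` at time `t₀`. -/
def Program.run {ℓ M N N₀ S T : ℕ} (P : Program ℓ M N N₀ S T) (H : Fin M → ZMod N)
    (G : (Fin ℓ → Fin M) → Fin N₀) (t₀ : ℕ) (m : Memory S) : ℕ → Memory S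
  | 0 => m
  | s + 1 => P.step H G (t₀ + s) (P.run H G t₀ m s)

theorem Program.step_congr {ℓ M N N₀ S T : ℕ} (P : Program ℓ M N N₀ S T) {H H' : Fin M → ZMod N}
    {G G' : (Fin ℓ → Fin M) → Fin N₀} (t : ℕ) (m : Memory S)
    (h : answer H' G' (P.access t m) = answer H G (P.access t m)) :
    P.step H' G' t m = P.step H G t m := by
  unfold Program.step
  split_ifs with ht
  · simp only [Program.access, ht, dif_pos] at h
    rw [h]
  · rfl

theorem Program.memoryAt_succ {ℓ M N N₀ S T : ℕ} (P : Program ℓ M N N₀ S T) (H : Fin M → ZMod N)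
    (G : (Fin ℓ → Fin M) → Fin N₀) (t : ℕ) :
    P.memoryAt H G (t + 1) = P.step H G t (P.memoryAt H G t) := rfl

theorem Program.run_memoryAt {ℓ M N N₀ S T : ℕ} (P : Program ℓ M N N₀ S T) (H : Fin M → ZMod N)
    (G : (Fin ℓ → Fin M) → Fin N₀) (t₀ s : ℕ) :
    P.run H G t₀ (P.memoryAt H G t₀) s = P.memoryAt H G (t₀ + s) := by
  induction s with
  | zero => rfl
  | succ s ih => rw [← add_assoc, P.memoryAt_succ, Program.run, ih]

/-- The query made at time `t`, the output tuples included. -/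
def Program.queryAt {ℓ M N N₀ S T : ℕ} (P : Program ℓ M N N₀ S T) (H : Fin M → ZMod N)
    (G : (Fin ℓ → Fin M) → Fin N₀) (t : ℕ) : Query ℓ M :=
  P.access t (P.memoryAt H G t)

theorem Program.queryAt_output_fst {ℓ M N N₀ S T : ℕ} (P : Program ℓ M N N₀ S T)
    (H : Fin M → ZMod N) (G : (Fin ℓ → Fin M) → Fin N₀) :
    P.queryAt H G T = .toG (P.result H G).1 := by
  simp [Program.queryAt, Program.access, Program.result]

theorem Program.queryAt_output_snd {ℓ M N N₀ S T : ℕ} (P : Program ℓ M N N₀ S T)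
    (H : Fin M → ZMod N) (G : (Fin ℓ → Fin M) → Fin N₀) :
    P.queryAt H G (T + 1) = .toG (P.result H G).2 := by
  simp [Program.queryAt, Program.access, Program.result, P.memoryAt_succ, Program.step]

/-- A tuple is useful for the target `y` if it is valid and its `H`-values sum to `y`. -/
def Useful {ℓ M N : ℕ} (H : Fin M → ZMod N) (y : ZMod N) (x : Fin ℓ → Fin M) : Prop :=
  IsValidTuple x ∧ ∑ i, H (x i) = y

open scoped Classical in
/-- The useful tuples that are queried before time `t`. -/
noncomputable def Program.usefulBefore {ℓ M N N₀ S T : ℕ} (P : Program ℓ M N N₀ S T)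
    (H : Fin M → ZMod N) (G : (Fin ℓ → Fin M) → Fin N₀) (y : ZMod N) (t : ℕ) :
    Finset (Fin ℓ → Fin M) :=
  {x | Useful H y x ∧ ∃ s < t, P.queryAt H G s = .toG x}

open scoped Classical in
/-- The useful tuples that are queried during `w` steps from time `t₀` on, if the memory is `m` at
time `t₀`. -/
noncomputable def Program.usefulFrom {ℓ M N N₀ S T : ℕ} (P : Program ℓ M N N₀ S T)
    (H : Fin M → ZMod N) (G : (Fin ℓ → Fin M) → Fin N₀) (y : ZMod N) (t₀ : ℕ) (m : Memory S)
    (w : ℕ) : Finset (Fin ℓ → Fin M) :=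
  {x | Useful H y x ∧ ∃ s < w, P.access (t₀ + s) (P.run H G t₀ m s) = .toG x}

theorem Program.mem_usefulBefore {ℓ M N N₀ S T : ℕ} {P : Program ℓ M N N₀ S T}
    {H : Fin M → ZMod N} {G : (Fin ℓ → Fin M) → Fin N₀} {y : ZMod N} {t : ℕ}
    {x : Fin ℓ → Fin M} :
    x ∈ P.usefulBefore H G y t ↔ Useful H y x ∧ ∃ s < t, P.queryAt H G s = .toG x := by
  simp [Program.usefulBefore]

theorem Program.mem_usefulFrom {ℓ M N N₀ S T : ℕ} {P : Program ℓ M N N₀ S T}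
    {H : Fin M → ZMod N} {G : (Fin ℓ → Fin M) → Fin N₀} {y : ZMod N} {t₀ : ℕ} {m : Memory S}
    {w : ℕ} {x : Fin ℓ → Fin M} :
    x ∈ P.usefulFrom H G y t₀ m w ↔
      Useful H y x ∧ ∃ s < w, P.access (t₀ + s) (P.run H G t₀ m s) = .toG x := by
  simp [Program.usefulFrom]

theorem Program.usefulBefore_mono {ℓ M N N₀ S T : ℕ} (P : Program ℓ M N N₀ S T)
    (H : Fin M → ZMod N) (G : (Fin ℓ → Fin M) → Fin N₀) (y : ZMod N) {s t : ℕ} (h : s ≤ t) :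
    P.usefulBefore H G y s ⊆ P.usefulBefore H G y t := by
  intro x hx
  rw [Program.mem_usefulBefore] at hx ⊢
  obtain ⟨hu, u, hus, hq⟩ := hx
  exact ⟨hu, u, hus.trans_le h, hq⟩

theorem Program.usefulFrom_memoryAt {ℓ M N N₀ S T : ℕ} (P : Program ℓ M N N₀ S T)
    (H : Fin M → ZMod N) (G : (Fin ℓ → Fin M) → Fin N₀) (y : ZMod N) (t₀ w : ℕ)
    (x : Fin ℓ → Fin M) :
    x ∈ P.usefulFrom H G y t₀ (P.memoryAt H G t₀) w ↔
      Useful H y x ∧ ∃ s < w, P.queryAt H G (t₀ + s) = .toG x := by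
  simp only [Program.mem_usefulFrom, Program.run_memoryAt, Program.queryAt]

/-! ### Collisions of `G` among few useful tuples -/

theorem Program.memoryAt_update {ℓ M N N₀ S T : ℕ} (P : Program ℓ M N N₀ S T)
    (H : Fin M → ZMod N) (G : (Fin ℓ → Fin M) → Fin N₀) (x : Fin ℓ → Fin M) (v : Fin N₀) (t : ℕ)
    (h : ∀ s < t, P.queryAt H G s ≠ .toG x) :
    P.memoryAt H (Function.update G x v) t = P.memoryAt H G t := by
  induction t with
  | zero => rfl
  | succ t ih =>
    rw [P.memoryAt_succ, P.memoryAt_succ, ih fun s hs => h s (hs.trans t.lt_succ_self)]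
    apply P.step_congr
    have ht := h t t.lt_succ_self
    rw [Program.queryAt] at ht
    generalize P.access t (P.memoryAt H G t) = Q at ht
    cases Q with
    | toH z => rfl
    | toG z =>
      have hz : z ≠ x := fun hzx => ht (by rw [hzx])
      simp [answer, update_of_ne hz]

theorem Program.queryAt_update {ℓ M N N₀ S T : ℕ} (P : Program ℓ M N N₀ S T)
    (H : Fin M → ZMod N) (G : (Fin ℓ → Fin M) → Fin N₀) (x : Fin ℓ → Fin M) (v : Fin N₀) (t : ℕ)
    (h : ∀ s < t, P.queryAt H G s ≠ .toG x) :
    P.queryAt H (Function.update G x v) t = P.queryAt H G t := by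
  rw [Program.queryAt, P.memoryAt_update H G x v t h, Program.queryAt]

/-- The tuple `x` is queried for the first time after `x'`, and at this time at most `k` useful
tuples have been queried. -/
def Program.QueriedAfter {ℓ M N N₀ S T : ℕ} (P : Program ℓ M N N₀ S T)
    (H : Fin M → ZMod N) (y : ZMod N) (k : ℕ) (x' x : Fin ℓ → Fin M)
    (G : (Fin ℓ → Fin M) → Fin N₀) : Prop :=
  ∃ t < T + 2, P.queryAt H G t = .toG x ∧ (∀ s < t, P.queryAt H G s ≠ .toG x) ∧
    (∃ s < t, P.queryAt H G s = .toG x') ∧ #(P.usefulBefore H G y (t + 1)) ≤ k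

theorem Program.queriedAfter_update {ℓ M N N₀ S T : ℕ} {P : Program ℓ M N N₀ S T}
    {H : Fin M → ZMod N} {y : ZMod N} {k : ℕ} {x' x : Fin ℓ → Fin M}
    {G : (Fin ℓ → Fin M) → Fin N₀} (h : P.QueriedAfter H y k x' x G) (v : Fin N₀) :
    P.QueriedAfter H y k x' x (Function.update G x v) := by
  obtain ⟨t, htT, htx, hfst, ⟨s, hst, hsx'⟩, hk⟩ := h
  have hq : ∀ s ≤ t, P.queryAt H (Function.update G x v) s = P.queryAt H G s := fun s hs =>
    P.queryAt_update H G x v s fun u hu => hfst u (hu.trans_le hs)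
  refine ⟨t, htT, by rw [hq t le_rfl, htx], fun u hu => by rw [hq u hu.le]; exact hfst u hu,
    ⟨s, hst, by rw [hq s hst.le, hsx']⟩, le_of_eq_of_le (congrArg card ?_) hk⟩
  ext z
  simp only [Program.mem_usefulBefore]
  refine and_congr_right fun _ => exists_congr fun u => and_congr_right fun hu => ?_
  rw [hq u (Nat.lt_succ_iff.1 hu)]

open scoped Classical in
/-- At most `k ^ 2` ordered pairs of useful tuples satisfy `QueriedAfter`: all these tuples are
queried up to the last time at which at most `k` useful tuples have been queried. -/
theorem Program.card_queriedAfter_le {ℓ M N N₀ S T : ℕ} (P : Program ℓ M N N₀ S T)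
    (H : Fin M → ZMod N) (y : ZMod N) (k : ℕ) (G : (Fin ℓ → Fin M) → Fin N₀) :
    #{q : (Fin ℓ → Fin M) × (Fin ℓ → Fin M) |
      Useful H y q.1 ∧ Useful H y q.2 ∧ P.QueriedAfter H y k q.1 q.2 G} ≤ k ^ 2 := by
  set A : Finset ℕ := {t ∈ range (T + 2) | #(P.usefulBefore H G y (t + 1)) ≤ k} with hA
  rcases A.eq_empty_or_nonempty with h | hne
  · refine le_of_eq_of_le (card_eq_zero.2 (filter_eq_empty_iff.2 ?_)) (Nat.zero_le _)
    rintro ⟨x', x⟩ - ⟨-, -, t, htT, -, -, -, hk⟩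
    have : t ∈ A := mem_filter.2 ⟨mem_range.2 htT, hk⟩
    simp [h] at this
  · have hmax := A.max'_mem hne
    set t' := A.max' hne
    refine (card_le_card (t := P.usefulBefore H G y (t' + 1) ×ˢ P.usefulBefore H G y (t' + 1))
      ?_).trans ?_
    · rintro ⟨x', x⟩ hq
      obtain ⟨hu', hu, t, htT, htx, -, ⟨s, hst, hsx'⟩, hk⟩ := (mem_filter.1 hq).2
      have htt' : t ≤ t' := A.le_max' t (mem_filter.2 ⟨mem_range.2 htT, hk⟩)
      exact mem_product.2 ⟨Program.mem_usefulBefore.2 ⟨hu', s, by omega, hsx'⟩,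
        Program.mem_usefulBefore.2 ⟨hu, t, by omega, htx⟩⟩
    · rw [card_product, sq]
      have := (mem_filter.1 hmax).2
      exact Nat.mul_le_mul this this

open scoped Classical in
/-- For fixed `H`, a program that queries at most `k` useful tuples finds a nested collision with
probability at most `k ^ 2 / N₀`. -/
theorem Program.card_isNestedCollision_mul_le {ℓ M N N₀ S T : ℕ} (P : Program ℓ M N N₀ S T)
    (H : Fin M → ZMod N) (y : ZMod N) (k : ℕ) :
    #{G : (Fin ℓ → Fin M) → Fin N₀ | #(P.usefulBefore H G y (T + 2)) ≤ k ∧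
      IsNestedCollision H G y (P.result H G).1 (P.result H G).2} * N₀ ≤
      k ^ 2 * Fintype.card ((Fin ℓ → Fin M) → Fin N₀) := by
  set 𝓠 : Finset ((Fin ℓ → Fin M) × (Fin ℓ → Fin M)) :=
    {q | Useful H y q.1 ∧ Useful H y q.2 ∧ q.1 ≠ q.2} with h𝓠
  set A : (Fin ℓ → Fin M) × (Fin ℓ → Fin M) → Finset ((Fin ℓ → Fin M) → Fin N₀) :=
    fun q => {G | P.QueriedAfter H y k q.1 q.2 G} with hA
  have hsub : ({G | #(P.usefulBefore H G y (T + 2)) ≤ k ∧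
      IsNestedCollision H G y (P.result H G).1 (P.result H G).2} : Finset _) ⊆
      𝓠.biUnion fun q => {G ∈ A q | G q.2 = G q.1} := by
    intro G hG
    obtain ⟨hk, hcol⟩ := (mem_filter.1 hG).2
    have hT := P.queryAt_output_fst H G
    have hT' := P.queryAt_output_snd H G
    set x := (P.result H G).1
    set x' := (P.result H G).2
    have hex : ∃ t, P.queryAt H G t = .toG x := ⟨T, hT⟩
    have hex' : ∃ t, P.queryAt H G t = .toG x' := ⟨T + 1, hT'⟩
    have hle : Nat.find hex ≤ T := Nat.find_min' hex hT
    have hle' : Nat.find hex' ≤ T + 1 := Nat.find_min' hex' hT'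
    have hcard : ∀ t < T + 2, #(P.usefulBefore H G y (t + 1)) ≤ k := fun t ht =>
      (card_le_card (P.usefulBefore_mono H G y (by omega))).trans hk
    simp only [mem_biUnion, h𝓠, hA, mem_filter, mem_univ, true_and]
    rcases lt_trichotomy (Nat.find hex) (Nat.find hex') with hlt | heq | hgt
    · exact ⟨(x, x'), ⟨⟨hcol.valid_left, hcol.sum_left⟩, ⟨hcol.valid_right, hcol.sum_right⟩,
        hcol.ne⟩, ⟨Nat.find hex', by omega, Nat.find_spec hex', fun s hs => Nat.find_min hex' hs,
        ⟨_, hlt, Nat.find_spec hex⟩, hcard _ (by omega)⟩, hcol.collision.symm⟩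
    · have h1 := Nat.find_spec hex
      rw [heq, Nat.find_spec hex'] at h1
      exact absurd (Query.toG.inj h1).symm hcol.ne
    · exact ⟨(x', x), ⟨⟨hcol.valid_right, hcol.sum_right⟩, ⟨hcol.valid_left, hcol.sum_left⟩,
        hcol.ne.symm⟩, ⟨Nat.find hex, by omega, Nat.find_spec hex, fun s hs => Nat.find_min hex hs,
        ⟨_, hgt, Nat.find_spec hex'⟩, hcard _ (by omega)⟩, hcol.collision⟩
  have hone : ∀ q ∈ 𝓠, #{G ∈ A q | G q.2 = G q.1} * N₀ ≤ #(A q) := by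
    intro q hq
    have hne : q.1 ≠ q.2 := (mem_filter.1 hq).2.2.2
    have := card_filter_apply_eq_mul_card_le (A q) (fun _ => q.2) (fun G => G q.1)
      fun G hG v => ⟨mem_filter.2 ⟨mem_univ _, Program.queriedAfter_update (mem_filter.1 hG).2 v⟩,
        rfl, update_of_ne hne _ _⟩
    rwa [Fintype.card_fin] at this
  have hswap : ∑ q ∈ 𝓠, #(A q) = ∑ G, #{q ∈ 𝓠 | P.QueriedAfter H y k q.1 q.2 G} := by
    simp only [hA, card_filter]
    exact sum_comm
  calc _ ≤ (∑ q ∈ 𝓠, #{G ∈ A q | G q.2 = G q.1}) * N₀ :=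
        Nat.mul_le_mul_right _ ((card_le_card hsub).trans card_biUnion_le)
    _ ≤ ∑ q ∈ 𝓠, #(A q) := by
        rw [sum_mul]
        exact sum_le_sum hone
    _ ≤ ∑ _G : (Fin ℓ → Fin M) → Fin N₀, k ^ 2 := by
        rw [hswap]
        refine sum_le_sum fun G _ => (card_le_card ?_).trans (P.card_queriedAfter_le H y k G)
        intro q hq
        simp only [h𝓠, mem_filter, mem_univ, true_and] at hq ⊢
        exact ⟨hq.1.1, hq.1.2.1, hq.2⟩
    _ = _ := by rw [sum_const, card_univ, smul_eq_mul, mul_comm]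

/-! ### The points of `H` behind the queries of a segment -/

/-- The points whose `H`-value matters for the queries from time `t₀` on, if the memory is `m` at
time `t₀`. Every query is spread over `ℓ` time steps: a query to `H` is repeated, and a query to `G`
is replaced by its `ℓ` coordinates. -/
def Program.pointSeq {ℓ M N N₀ S T : ℕ} (P : Program ℓ M N N₀ S T) (hℓ : 0 < ℓ)
    (G : (Fin ℓ → Fin M) → Fin N₀) (t₀ : ℕ) (m : Memory S) (H : Fin M → ZMod N) (u : ℕ) : Fin M :=
  match P.access (t₀ + u / ℓ) (P.run H G t₀ m (u / ℓ)) with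
  | .toH x => x
  | .toG x => x ⟨u % ℓ, Nat.mod_lt _ hℓ⟩

theorem Program.run_congr {ℓ M N N₀ S T : ℕ} (P : Program ℓ M N N₀ S T) (hℓ : 0 < ℓ)
    (G : (Fin ℓ → Fin M) → Fin N₀) (t₀ : ℕ) (m : Memory S) {H H' : Fin M → ZMod N} (s : ℕ)
    (h : ∀ u < ℓ * s, H' (P.pointSeq hℓ G t₀ m H u) = H (P.pointSeq hℓ G t₀ m H u)) :
    P.run H' G t₀ m s = P.run H G t₀ m s := by
  induction s with
  | zero => rfl
  | succ s ih =>
    rw [Program.run, Program.run,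
      ih fun u hu => h u (hu.trans_le (Nat.mul_le_mul_left _ s.le_succ))]
    apply P.step_congr
    have hs := h (ℓ * s) ((Nat.mul_lt_mul_left hℓ).2 s.lt_succ_self)
    rw [Program.pointSeq, Nat.mul_div_cancel_left _ hℓ] at hs
    generalize P.access (t₀ + s) (P.run H G t₀ m s) = Q at hs
    cases Q with
    | toH z => exact congrArg Sum.inl hs
    | toG z => rfl

theorem Program.adaptive_pointSeq {ℓ M N N₀ S T : ℕ} (P : Program ℓ M N N₀ S T) (hℓ : 0 < ℓ)
    (G : (Fin ℓ → Fin M) → Fin N₀) (t₀ : ℕ) (m : Memory S) :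
    Adaptive (P.pointSeq hℓ G t₀ m) := by
  intro H H' t h
  have := P.run_congr hℓ G t₀ m (t / ℓ) fun u hu => h u (hu.trans_le (Nat.mul_div_le t ℓ))
  rw [Program.pointSeq, Program.pointSeq, this]

open scoped Classical in
theorem Program.card_usefulFrom_le {ℓ M N N₀ S T : ℕ} (P : Program ℓ M N N₀ S T) (hℓ : 0 < ℓ)
    (H : Fin M → ZMod N) (G : (Fin ℓ → Fin M) → Fin N₀) (y : ZMod N) (t₀ : ℕ) (m : Memory S)
    (w : ℕ) :
    #(P.usefulFrom H G y t₀ m w) ≤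
      #{B ∈ (range (ℓ * w)).powersetCard ℓ | HasFreshSum (P.pointSeq hℓ G t₀ m) y H B} := by
  have hinj : Set.InjOn (fun x : Fin ℓ → Fin M => univ.image x) (P.usefulFrom H G y t₀ m w) := by
    intro x hx x' hx' h
    rw [mem_coe, Program.mem_usefulFrom] at hx hx'
    refine (StrictMono.range_inj hx.1.1 hx'.1.1).1 ?_
    simpa using congrArg (fun A : Finset (Fin M) => (A : Set (Fin M))) h
  rw [← card_image_of_injOn hinj]
  refine card_le_card_hasFreshSum _ H _ ℓ y _ ?_ ?_ ?_
  all_goals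
    intro R hR
    obtain ⟨x, hx, rfl⟩ := mem_image.1 hR
    obtain ⟨⟨hval, hsum⟩, s, hs, hacc⟩ := Program.mem_usefulFrom.1 hx
  · rw [card_image_of_injective _ hval.injective, card_univ, Fintype.card_fin]
  · rw [sum_image hval.injective.injOn, hsum]
  · intro z hz
    obtain ⟨i, -, rfl⟩ := mem_image.1 hz
    refine ⟨ℓ * s + i, ?_, ?_⟩
    · calc ℓ * s + i < ℓ * s + ℓ := Nat.add_lt_add_left i.2 _
        _ = ℓ * (s + 1) := by ring
        _ ≤ ℓ * w := Nat.mul_le_mul_left _ hs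
    · have hdiv : (ℓ * s + i) / ℓ = s := by
        rw [Nat.mul_add_div hℓ, Nat.div_eq_of_lt i.2, add_zero]
      simp [Program.pointSeq, hdiv, hacc, Nat.mod_eq_of_lt i.2]

theorem Program.card_usefulFrom_le_length {ℓ M N N₀ S T : ℕ} (P : Program ℓ M N N₀ S T)
    (H : Fin M → ZMod N) (G : (Fin ℓ → Fin M) → Fin N₀) (y : ZMod N) (t₀ : ℕ) (m : Memory S)
    (w : ℕ) : #(P.usefulFrom H G y t₀ m w) ≤ w := by
  classical
  have hinj : Injective (Query.toG : (Fin ℓ → Fin M) → Query ℓ M) := fun _ _ => Query.toG.inj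
  rw [← card_image_of_injective _ hinj]
  refine (card_le_card (t := (range w).image fun s => P.access (t₀ + s) (P.run H G t₀ m s))
    ?_).trans (card_image_le.trans (card_range w).le)
  intro Q hQ
  obtain ⟨x, hx, rfl⟩ := mem_image.1 hQ
  obtain ⟨-, s, hs, hacc⟩ := Program.mem_usefulFrom.1 hx
  exact mem_image.2 ⟨s, mem_range.2 hs, hacc⟩

/-! ### The expected number of useful tuples -/

/-- Regardless of the memory, `t` queries reach at most `(ℓ t) ^ ℓ / N` useful tuples in
expectation. -/
theorem Program.sum_card_usefulBefore_mul_le {ℓ M N N₀ S T : ℕ} [NeZero N]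
    (P : Program ℓ M N N₀ S T) (hℓ : 0 < ℓ) (G : (Fin ℓ → Fin M) → Fin N₀) (y : ZMod N) (t : ℕ) :
    (∑ H : Fin M → ZMod N, #(P.usefulBefore H G y t)) * N ≤
      (ℓ * t) ^ ℓ * Fintype.card (Fin M → ZMod N) := by
  classical
  have h := (P.adaptive_pointSeq hℓ G 0 P.init).sum_card_hasFreshSum_mul_le (ℓ * t) hℓ y
  rw [ZMod.card] at h
  have hle : ∀ H : Fin M → ZMod N, #(P.usefulBefore H G y t) ≤
      #{B ∈ (range (ℓ * t)).powersetCard ℓ | HasFreshSum (P.pointSeq hℓ G 0 P.init) y H B} := by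
    intro H
    refine (card_le_card fun x hx => ?_).trans (P.card_usefulFrom_le hℓ H G y 0 P.init t)
    obtain ⟨hu, s, hs, hq⟩ := Program.mem_usefulBefore.1 hx
    have hrun := P.run_memoryAt H G 0 s
    rw [Program.memoryAt, zero_add] at hrun
    refine Program.mem_usefulFrom.2 ⟨hu, s, hs, ?_⟩
    rw [hrun, zero_add]
    exact hq
  refine le_trans (Nat.mul_le_mul_right _ (sum_le_sum fun H _ => hle H)) ?_
  exact h

open scoped Classical in
/-- If the queries are cut into `J` segments of length `w`, then the expected number of useful
tuples is controlled by the probability that some single memory content at the start of a segment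
makes the points queried in this segment crowded. -/
theorem Program.sum_card_usefulBefore_le {ℓ M N N₀ S T : ℕ} [NeZero N]
    (P : Program ℓ M N N₀ S T) (hℓ : 0 < ℓ) (G : (Fin ℓ → Fin M) → Fin N₀) (y : ZMod N)
    {t J w : ℕ} (htJ : t ≤ J * w) (r c : ℕ)
    (hc : ∀ t₀ m, #{H : Fin M → ZMod N | Crowded (P.pointSeq hℓ G t₀ m) (ℓ * w) r ℓ H} ≤ c) :
    ∑ H : Fin M → ZMod N, #(P.usefulBefore H G y t) ≤
      J * (ℓ.factorial * r ^ ℓ * Fintype.card (Fin M → ZMod N) + 2 ^ S * (w * c)) := by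
  have hsub : ∀ H : Fin M → ZMod N, P.usefulBefore H G y t ⊆
      (range J).biUnion fun j => P.usefulFrom H G y (j * w) (P.memoryAt H G (j * w)) w := by
    intro H x hx
    obtain ⟨hu, s, hs, hq⟩ := Program.mem_usefulBefore.1 hx
    have hw : 0 < w := Nat.pos_of_ne_zero fun h0 => by rw [h0] at htJ; omega
    refine mem_biUnion.2 ⟨s / w, mem_range.2 ?_, (P.usefulFrom_memoryAt H G y _ w x).2 ⟨hu, s % w,
      Nat.mod_lt _ hw, by rw [Nat.div_add_mod' s w, hq]⟩⟩
    exact (Nat.div_lt_iff_lt_mul hw).2 (hs.trans_le htJ)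
  have hseg : ∀ (H : Fin M → ZMod N) (t₀ : ℕ), #(P.usefulFrom H G y t₀ (P.memoryAt H G t₀) w) ≤
      ℓ.factorial * r ^ ℓ +
        ∑ m : Memory S, if Crowded (P.pointSeq hℓ G t₀ m) (ℓ * w) r ℓ H then w else 0 := by
    intro H t₀
    set m₀ := P.memoryAt H G t₀
    by_cases hcr : Crowded (P.pointSeq hℓ G t₀ m₀) (ℓ * w) r ℓ H
    · refine (P.card_usefulFrom_le_length H G y t₀ m₀ w).trans (le_add_left ?_)
      have := single_le_sum (f := fun m : Memory S =>
        if Crowded (P.pointSeq hℓ G t₀ m) (ℓ * w) r ℓ H then w else 0)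
        (fun _ _ => Nat.zero_le _) (mem_univ m₀)
      rwa [if_pos hcr] at this
    · exact le_add_right ((P.card_usefulFrom_le hℓ H G y t₀ m₀ w).trans
        (card_hasFreshSum_le_of_not_crowded hcr y))
  calc ∑ H : Fin M → ZMod N, #(P.usefulBefore H G y t)
      ≤ ∑ H : Fin M → ZMod N, ∑ j ∈ range J, (ℓ.factorial * r ^ ℓ +
          ∑ m : Memory S, if Crowded (P.pointSeq hℓ G (j * w) m) (ℓ * w) r ℓ H then w else 0) :=
        sum_le_sum fun H _ => (card_le_card (hsub H)).trans
          (card_biUnion_le.trans (sum_le_sum fun j _ => hseg H _))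
    _ = ∑ j ∈ range J, (ℓ.factorial * r ^ ℓ * Fintype.card (Fin M → ZMod N) + ∑ m : Memory S,
          w * #{H : Fin M → ZMod N | Crowded (P.pointSeq hℓ G (j * w) m) (ℓ * w) r ℓ H}) := by
        rw [sum_comm]
        refine sum_congr rfl fun j _ => ?_
        rw [sum_add_distrib, sum_const, card_univ, smul_eq_mul, mul_comm, sum_comm]
        congr 1
        refine sum_congr rfl fun m _ => ?_
        rw [← sum_filter, sum_const, smul_eq_mul, mul_comm]
    _ ≤ ∑ j ∈ range J, (ℓ.factorial * r ^ ℓ * Fintype.card (Fin M → ZMod N) +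
          ∑ _m : Memory S, w * c) :=
        sum_le_sum fun j _ => Nat.add_le_add_left
          (sum_le_sum fun m _ => Nat.mul_le_mul_left _ (hc _ _)) _
    _ = _ := by simp

/-! ### From expected counts to the success probability -/

open scoped Classical in
/-- If the expected number of useful tuples is at most `E` for every `G`, then Markov's inequality
and the collision bound control the number of pairs of oracles on which the program succeeds. -/
theorem Program.card_success_le {ℓ M N N₀ S T : ℕ} [NeZero N] [NeZero N₀]
    (P : Program ℓ M N N₀ S T) (y : ZMod N) (E : ℝ) (k : ℕ)
    (hE : ∀ G : (Fin ℓ → Fin M) → Fin N₀,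
      (∑ H : Fin M → ZMod N, (#(P.usefulBefore H G y (T + 2)) : ℝ)) ≤
        E * Fintype.card (Fin M → ZMod N)) :
    (∑ H : Fin M → ZMod N, (#{G : (Fin ℓ → Fin M) → Fin N₀ |
        IsNestedCollision H G y (P.result H G).1 (P.result H G).2} : ℝ)) ≤
      (E / (k + 1) + (k : ℝ) ^ 2 / N₀) * (Fintype.card (Fin M → ZMod N) *
        Fintype.card ((Fin ℓ → Fin M) → Fin N₀)) := by
  set hH : ℝ := (Fintype.card (Fin M → ZMod N) : ℝ)
  set gG : ℝ := (Fintype.card ((Fin ℓ → Fin M) → Fin N₀) : ℝ) with hgG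
  have hN₀ : (0 : ℝ) < N₀ := Nat.cast_pos.2 (NeZero.pos N₀)
  have hpt : ∀ H : Fin M → ZMod N, (#{G : (Fin ℓ → Fin M) → Fin N₀ |
        IsNestedCollision H G y (P.result H G).1 (P.result H G).2} : ℝ) ≤
      (∑ G : (Fin ℓ → Fin M) → Fin N₀, (#(P.usefulBefore H G y (T + 2)) : ℝ)) / (k + 1) +
        (k : ℝ) ^ 2 / N₀ * gG := by
    intro H
    have hsplit : #{G : (Fin ℓ → Fin M) → Fin N₀ |
        IsNestedCollision H G y (P.result H G).1 (P.result H G).2} ≤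
      #{G : (Fin ℓ → Fin M) → Fin N₀ | k + 1 ≤ #(P.usefulBefore H G y (T + 2))} +
      #{G : (Fin ℓ → Fin M) → Fin N₀ | #(P.usefulBefore H G y (T + 2)) ≤ k ∧
        IsNestedCollision H G y (P.result H G).1 (P.result H G).2} := by
      refine (card_le_card fun G hG => ?_).trans (card_union_le _ _)
      simp only [mem_union, mem_filter, mem_univ, true_and] at hG ⊢
      rcases Nat.lt_or_ge k #(P.usefulBefore H G y (T + 2)) with h | h
      · exact Or.inl h
      · exact Or.inr ⟨h, hG⟩
    have hmarkov : #{G : (Fin ℓ → Fin M) → Fin N₀ | k + 1 ≤ #(P.usefulBefore H G y (T + 2))} *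
        (k + 1) ≤ ∑ G : (Fin ℓ → Fin M) → Fin N₀, #(P.usefulBefore H G y (T + 2)) := by
      rw [← smul_eq_mul]
      refine (card_nsmul_le_sum _ (fun G => #(P.usefulBefore H G y (T + 2))) _
        fun G hG => (mem_filter.1 hG).2).trans ?_
      exact sum_le_sum_of_subset (filter_subset _ _)
    have hcol := P.card_isNestedCollision_mul_le H y k
    have h1 : (#{G : (Fin ℓ → Fin M) → Fin N₀ | k + 1 ≤ #(P.usefulBefore H G y (T + 2))} : ℝ) ≤
        (∑ G : (Fin ℓ → Fin M) → Fin N₀, (#(P.usefulBefore H G y (T + 2)) : ℝ)) / (k + 1) := by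
      rw [le_div_iff₀ (by positivity)]
      exact_mod_cast hmarkov
    have h2 : (#{G : (Fin ℓ → Fin M) → Fin N₀ | #(P.usefulBefore H G y (T + 2)) ≤ k ∧
        IsNestedCollision H G y (P.result H G).1 (P.result H G).2} : ℝ) ≤
        (k : ℝ) ^ 2 / N₀ * gG := by
      rw [div_mul_eq_mul_div, le_div_iff₀ hN₀, hgG]
      exact_mod_cast hcol
    exact le_trans (by exact_mod_cast hsplit) (add_le_add h1 h2)
  have hsum : (∑ H : Fin M → ZMod N, ∑ G : (Fin ℓ → Fin M) → Fin N₀,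
      (#(P.usefulBefore H G y (T + 2)) : ℝ)) ≤ gG * (E * hH) := by
    rw [sum_comm]
    refine (sum_le_card_nsmul _ _ _ fun G _ => hE G).trans (le_of_eq ?_)
    rw [card_univ, nsmul_eq_mul]
  refine (sum_le_sum fun H _ => hpt H).trans ?_
  rw [sum_add_distrib, ← sum_div, sum_const, card_univ, nsmul_eq_mul]
  calc _ ≤ gG * (E * hH) / (k + 1) + hH * ((k : ℝ) ^ 2 / N₀ * gG) := by gcongr
    _ = _ := by ring

theorem bind_apply_le_of_forall_le {α β : Type*} (μ : PMF α) (f : α → PMF β) (b : β) (c : ENNReal)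
    (h : ∀ a, f a b ≤ c) : μ.bind f b ≤ c := by
  rw [PMF.bind_apply]
  calc ∑' a, μ a * f a b ≤ ∑' a, μ a * c := ENNReal.tsum_le_tsum fun a => by gcongr; exact h a
    _ = c := by rw [ENNReal.tsum_mul_right, μ.tsum_coe, one_mul]

open scoped Classical in
/-- The success probability is at most the largest one of a deterministic program with a fixed
target. -/
theorem successProbability_le {ℓ M N N₀ S T : ℕ} [NeZero N] [NeZero N₀] (D : PMF (ZMod N))
    (A : ClassicalAlgorithm ℓ M N N₀ S T) (ε : ℝ) (hε : 0 ≤ ε)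
    (h : ∀ (P : Program ℓ M N N₀ S T) (y : ZMod N),
      (∑ H : Fin M → ZMod N, (#{G : (Fin ℓ → Fin M) → Fin N₀ |
        IsNestedCollision H G y (P.result H G).1 (P.result H G).2} : ℝ)) ≤
      ε * (Fintype.card (Fin M → ZMod N) * Fintype.card ((Fin ℓ → Fin M) → Fin N₀))) :
    successProbability D A ≤ ε := by
  refine ENNReal.toReal_le_of_le_ofReal hε ?_
  refine bind_apply_le_of_forall_le _ _ _ _ fun y => bind_apply_le_of_forall_le _ _ _ _ fun P => ?_
  have hG : ∀ H : Fin M → ZMod N, (PMF.uniformOfFintype ((Fin ℓ → Fin M) → Fin N₀)).bind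
      (fun G => PMF.pure (IsNestedCollision H G y (P.result H G).1 (P.result H G).2)) True =
      (Fintype.card ((Fin ℓ → Fin M) → Fin N₀) : ENNReal)⁻¹ *
        (#{G : (Fin ℓ → Fin M) → Fin N₀ |
          IsNestedCollision H G y (P.result H G).1 (P.result H G).2} : ENNReal) := by
    intro H
    rw [PMF.bind_apply, tsum_fintype]
    simp only [PMF.uniformOfFintype_apply, PMF.pure_apply, ← mul_sum]
    congr 1
    rw [card_filter]
    push_cast
    refine sum_congr rfl fun G _ => ?_
    by_cases hc : IsNestedCollision H G y (P.result H G).1 (P.result H G).2 <;> simp [hc]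
  rw [PMF.bind_apply, tsum_fintype]
  simp only [PMF.uniformOfFintype_apply, hG, ← mul_sum]
  have hH0 : (Fintype.card (Fin M → ZMod N) : ENNReal) ≠ 0 :=
    Nat.cast_ne_zero.2 Fintype.card_ne_zero
  have hG0 : (Fintype.card ((Fin ℓ → Fin M) → Fin N₀) : ENNReal) ≠ 0 :=
    Nat.cast_ne_zero.2 Fintype.card_ne_zero
  have key := ENNReal.ofReal_le_ofReal (h P y)
  rw [ENNReal.ofReal_sum_of_nonneg (fun _ _ => Nat.cast_nonneg _), ENNReal.ofReal_mul hε,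
    ENNReal.ofReal_mul (Nat.cast_nonneg _)] at key
  simp only [ENNReal.ofReal_natCast] at key
  rw [ENNReal.inv_mul_le_iff hH0 (ENNReal.natCast_ne_top _),
    ENNReal.inv_mul_le_iff hG0 (ENNReal.natCast_ne_top _)]
  refine key.trans (le_of_eq ?_)
  ring

/-! ### Choice of parameters -/

/-- A program of success probability `p` reaches `Ω(√N₀)` useful tuples in expectation. -/
theorem le_of_le_successProbability {ℓ M N N₀ S T : ℕ} [NeZero N] [NeZero N₀] (D : PMF (ZMod N))
    (A : ClassicalAlgorithm ℓ M N N₀ S T) {p E : ℝ} (hp : 0 < p) (hE0 : 0 ≤ E)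
    (hE : ∀ (P : Program ℓ M N N₀ S T) (y : ZMod N) (G : (Fin ℓ → Fin M) → Fin N₀),
      (∑ H : Fin M → ZMod N, (#(P.usefulBefore H G y (T + 2)) : ℝ)) ≤
        E * Fintype.card (Fin M → ZMod N))
    (hA : p ≤ successProbability D A) : p / 2 * √(p / 2) * √N₀ ≤ E := by
  have hN₀ : (0 : ℝ) < N₀ := Nat.cast_pos.2 (NeZero.pos N₀)
  -- With `k = ⌊δ⌋`, collisions among at most `k` useful tuples account for half of `p`; the other
  -- half has to come from Markov's inequality at `k + 1 > δ`.
  set δ : ℝ := √(p / 2) * √N₀ with hδ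
  have hδ0 : 0 < δ := by positivity
  have hδ2 : δ ^ 2 = p / 2 * N₀ := by
    rw [hδ, mul_pow, Real.sq_sqrt (by positivity), Real.sq_sqrt hN₀.le]
  set k : ℕ := ⌊δ⌋₊
  have hk : (k : ℝ) ≤ δ := Nat.floor_le hδ0.le
  have hk' : δ < k + 1 := Nat.lt_floor_add_one δ
  have h1 : E / (k + 1) ≤ E / δ := by gcongr
  have h2 : (k : ℝ) ^ 2 / N₀ ≤ p / 2 := by
    rw [div_le_iff₀ hN₀, ← hδ2]
    gcongr
  have h3 := hA.trans (successProbability_le D A (E / (k + 1) + (k : ℝ) ^ 2 / N₀) (by positivity)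
    fun P y => P.card_success_le y E k (hE P y))
  have h4 : p / 2 ≤ E / δ := by linarith
  rw [le_div_iff₀ hδ0] at h4
  rwa [mul_assoc]

theorem pow_div_factorial_le_exp_neg {x : ℝ} (hx : 0 ≤ x) {r : ℕ} (h : x * Real.exp 2 ≤ r) :
    x ^ r / r.factorial ≤ Real.exp (-r) := by
  have h1 := Real.pow_div_factorial_le_exp (x * Real.exp 2) (by positivity) r
  have h2 : x ^ r / r.factorial = (x * Real.exp 2) ^ r / r.factorial * Real.exp (-(2 * r)) := by
    rw [mul_pow, ← Real.exp_nat_mul, mul_comm (2 : ℝ), Real.exp_neg]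
    field_simp
  rw [h2]
  calc _ ≤ Real.exp r * Real.exp (-(2 * r)) := by
        gcongr
        exact h1.trans (Real.exp_le_exp.2 h)
    _ = Real.exp (-r) := by rw [← Real.exp_add]; ring_nf

/-- Bound on the expected number of useful tuples that results from cutting the queries into `J`
segments of length `w`. -/
theorem Program.sum_card_usefulBefore_le_segments {ℓ M N N₀ S T : ℕ} [NeZero N]
    (P : Program ℓ M N N₀ S T) (hℓ : 0 < ℓ) (G : (Fin ℓ → Fin M) → Fin N₀) (y : ZMod N)
    {t J w : ℕ} (htJ : t ≤ J * w) (r : ℕ) {x : ℝ} (hx : ((ℓ * w : ℕ) : ℝ) ^ ℓ / N ≤ x)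
    (hxr : x * Real.exp 2 ≤ r) :
    (∑ H : Fin M → ZMod N, (#(P.usefulBefore H G y t) : ℝ)) ≤
      J * (ℓ.factorial * (r : ℝ) ^ ℓ + 2 ^ S * (w * (ℓ * N * Real.exp (-r)))) *
        Fintype.card (Fin M → ZMod N) := by
  classical
  have hN : (0 : ℝ) < N := Nat.cast_pos.2 (NeZero.pos N)
  have hx0 : 0 ≤ x := le_trans (by positivity) hx
  set K : ℕ := ℓ * N * ((ℓ * w) ^ ℓ).choose r * Fintype.card (Fin M → ZMod N) with hK
  have hcast : ((K / N ^ r : ℕ) : ℝ) ≤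
      ℓ * N * Real.exp (-r) * Fintype.card (Fin M → ZMod N) := by
    calc ((K / N ^ r : ℕ) : ℝ) ≤ (K : ℝ) / ((N ^ r : ℕ) : ℝ) := Nat.cast_div_le
      _ = ℓ * N * ((((ℓ * w) ^ ℓ).choose r : ℕ) : ℝ) * Fintype.card (Fin M → ZMod N) /
          (N : ℝ) ^ r := by rw [hK]; push_cast; rfl
      _ ≤ ℓ * N * ((((ℓ * w) ^ ℓ : ℕ) : ℝ) ^ r / r.factorial) *
          Fintype.card (Fin M → ZMod N) / (N : ℝ) ^ r := by
          gcongr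
          exact Nat.choose_le_pow_div _ _
      _ = ℓ * N * ((((ℓ * w : ℕ) : ℝ) ^ ℓ / N) ^ r / r.factorial) *
          Fintype.card (Fin M → ZMod N) := by
          rw [div_pow]
          push_cast
          field_simp
      _ ≤ ℓ * N * (x ^ r / r.factorial) * Fintype.card (Fin M → ZMod N) := by gcongr
      _ ≤ _ := by
          gcongr
          exact pow_div_factorial_le_exp_neg hx0 hxr
  have h := P.sum_card_usefulBefore_le hℓ G y htJ r (K / N ^ r) fun t₀ m => by
    rw [Nat.le_div_iff_mul_le (pow_pos (NeZero.pos N) r)]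
    have := (P.adaptive_pointSeq hℓ G t₀ m).card_crowded_mul_le (ℓ * w) r ℓ
    rwa [ZMod.card] at this
  calc (∑ H : Fin M → ZMod N, (#(P.usefulBefore H G y t) : ℝ))
      ≤ J * (ℓ.factorial * (r : ℝ) ^ ℓ * Fintype.card (Fin M → ZMod N) +
          2 ^ S * (w * ((K / N ^ r : ℕ) : ℝ))) := by exact_mod_cast h
    _ ≤ J * (ℓ.factorial * (r : ℝ) ^ ℓ * Fintype.card (Fin M → ZMod N) +
          2 ^ S * (w * (ℓ * N * Real.exp (-r) * Fintype.card (Fin M → ZMod N)))) := by gcongr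
    _ = _ := by ring

/-- The number of segments fits: with `w = ⌈Q⌉` and `T > Q ≥ 1`, about `T / Q` segments cover
`T + 2` steps. -/
theorem exists_segments {T : ℕ} {Q : ℝ} (hQ : 1 ≤ Q) (hT : Q < T) :
    ∃ J : ℕ, T + 2 ≤ J * ⌈Q⌉₊ ∧ (J : ℝ) ≤ 4 * T / Q := by
  have hw : Q ≤ ⌈Q⌉₊ := Nat.le_ceil Q
  have hw0 : 0 < ⌈Q⌉₊ := Nat.ceil_pos.2 (by linarith)
  refine ⟨(T + 2) / ⌈Q⌉₊ + 1, ?_, ?_⟩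
  · rw [add_mul, one_mul]
    exact (Nat.lt_div_mul_add hw0).le
  · have h1 : (((T + 2) / ⌈Q⌉₊ : ℕ) : ℝ) ≤ (T + 2) / Q := by
      refine Nat.cast_div_le.trans ?_
      push_cast
      gcongr
    have h2 : (1 : ℝ) ≤ T / Q := by rw [le_div_iff₀ (by linarith)]; linarith
    have h3 : ((T : ℝ) + 2) / Q ≤ 3 * T / Q := by gcongr; linarith
    have h4 : 4 * (T : ℝ) / Q = 3 * T / Q + T / Q := by ring
    push_cast
    linarith

/-- The contribution of the crowded segments is bounded: `S ≥ a log N` makes `exp (-ρ S)` beat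
both the number `2 ^ S` of memory contents and the powers of `N`. -/
theorem two_pow_mul_exp_le {ℓ N S w : ℕ} {a ρ : ℝ} (hN : 1 ≤ N) (ha : 0 < a)
    (haS : a * Real.log N ≤ S) (hρ : 2 / a + 2 ≤ ρ) (hw : (w : ℝ) ≤ 2 * (N * S)) :
    (2 : ℝ) ^ S * (w * (ℓ * N * Real.exp (-(ρ * S)))) ≤ 2 * ℓ := by
  have hN0 : (0 : ℝ) < N := Nat.cast_pos.2 hN
  have h2 : (2 : ℝ) ^ S ≤ Real.exp S := by
    rw [← mul_one (S : ℝ), Real.exp_nat_mul]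
    gcongr
    linarith [Real.add_one_le_exp (1 : ℝ)]
  have hNe : (N : ℝ) ≤ Real.exp (S / a) := by
    rw [← Real.log_le_iff_le_exp hN0, le_div_iff₀ ha, mul_comm]
    exact haS
  have hSe : (S : ℝ) ≤ Real.exp S := by linarith [Real.add_one_le_exp (S : ℝ)]
  calc (2 : ℝ) ^ S * (w * (ℓ * N * Real.exp (-(ρ * S))))
      ≤ Real.exp S * (2 * (Real.exp (S / a) * Real.exp S) *
          (ℓ * Real.exp (S / a) * Real.exp (-(ρ * S)))) := by
        gcongr
        exact hw.trans (by gcongr)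
    _ = 2 * ℓ * Real.exp (S + S / a + S + S / a + -(ρ * S)) := by
        simp only [Real.exp_add]
        ring
    _ ≤ 2 * ℓ * 1 := by
        gcongr
        rw [Real.exp_le_one_iff]
        have : (2 / a + 2) * S ≤ ρ * S := by gcongr
        have h' : (2 / a + 2) * (S : ℝ) = S + S / a + S + S / a := by ring
        linarith
    _ = 2 * ℓ := mul_one _

/-- The tradeoff in the form `T ≥ Ω(√N₀ (N S) ^ (1 / ℓ) / S ^ ℓ)`. If `T ≤ (N S) ^ (1 / ℓ)`, the
bound for all queries at once suffices; otherwise they are cut into segments of this length. -/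
theorem exists_tradeoff (ℓ : ℕ) (hℓ : 0 < ℓ) (p a : ℝ) (hp : 0 < p) (ha : 0 < a) :
    ∃ C : ℝ, 0 < C ∧ ∃ N₁ : ℕ, ∀ (N M N₀ S T : ℕ) [NeZero N] [NeZero N₀], N₁ ≤ N → 1 ≤ S →
      a * Real.log N ≤ S →
      ∀ (D : PMF (ZMod N)) (A : ClassicalAlgorithm ℓ M N N₀ S T),
        p ≤ successProbability D A →
          C * (√N₀ * ((N : ℝ) * S) ^ (1 / (ℓ : ℝ))) ≤ (S : ℝ) ^ ℓ * T := by
  set c₁ : ℝ := p / 2 * √(p / 2) with hc₁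
  have hc₁0 : 0 < c₁ := by positivity
  -- Families of `r = ρ S` disjoint sets are excluded: the first summand makes their probability
  -- at most `ℓ N exp (-r)`, the second one pays for the `2 ^ S` memory contents and powers of `N`.
  obtain ⟨ρ, hρ⟩ := exists_nat_ge (((2 * ℓ : ℝ) ^ ℓ) * Real.exp 2 + (2 / a + 2))
  have hρ1 : ((2 * ℓ : ℝ) ^ ℓ) * Real.exp 2 ≤ ρ := le_trans (by linarith [div_pos two_pos ha]) hρ
  have hρ2 : 2 / a + 2 ≤ (ρ : ℝ) := le_trans (le_add_of_nonneg_left (by positivity)) hρ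
  set c₂ : ℝ := ℓ.factorial * (ρ : ℝ) ^ ℓ + 2 * ℓ with hc₂
  set c₃ : ℝ := (3 * ℓ : ℝ) ^ ℓ + 4 * c₂ with hc₃
  have hℓ' : (0 : ℝ) < ℓ := Nat.cast_pos.2 hℓ
  have hc₂0 : 0 < c₂ := by positivity
  have hc₃0 : 0 < c₃ := by positivity
  obtain ⟨N₁, hN₁⟩ := exists_nat_gt ((2 * ℓ : ℝ) ^ ℓ / c₁)
  refine ⟨c₁ / c₃, by positivity, N₁, ?_⟩
  intro N M N₀ S T _ _ hN hS haS D A hA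
  have hN1 : 1 ≤ N := NeZero.pos N
  have hNR : (1 : ℝ) ≤ N := Nat.one_le_cast.2 hN1
  have hSR : (1 : ℝ) ≤ S := Nat.one_le_cast.2 hS
  have hN₀ : (1 : ℝ) ≤ √N₀ := Real.one_le_sqrt.2 (Nat.one_le_cast.2 (NeZero.pos N₀))
  set Q : ℝ := ((N : ℝ) * S) ^ (1 / (ℓ : ℝ)) with hQ
  have hNS : (1 : ℝ) ≤ N * S := one_le_mul_of_one_le_of_one_le hNR hSR
  have hQ1 : 1 ≤ Q := Real.one_le_rpow hNS (by positivity)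
  have hQ0 : 0 < Q := by linarith
  have hQℓ : Q ^ ℓ = N * S := by
    rw [hQ, one_div, Real.rpow_inv_natCast_pow (by positivity) hℓ.ne']
  have hSℓ : (S : ℝ) ≤ (S : ℝ) ^ ℓ := le_self_pow₀ hSR hℓ.ne'
  have hshort : c₁ * √N₀ ≤ (ℓ * (T + 2) : ℝ) ^ ℓ / N := by
    refine le_of_le_successProbability D A hp (by positivity) (fun P y G => ?_) hA
    rw [div_mul_eq_mul_div, le_div_iff₀ (by positivity)]
    exact_mod_cast P.sum_card_usefulBefore_mul_le hℓ G y (T + 2)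
  -- Without queries, only the two output tuples can be useful, and that is too unlikely for large
  -- `N`. This allows to replace `T + 2` by `3 * T`.
  have hT : T ≠ 0 := by
    rintro rfl
    have h1 : c₁ ≤ (2 * ℓ : ℝ) ^ ℓ / N := by
      refine (le_mul_of_one_le_right hc₁0.le hN₀).trans (hshort.trans_eq ?_)
      push_cast
      ring
    have h2 : (2 * ℓ : ℝ) ^ ℓ / c₁ < N := hN₁.trans_le (Nat.cast_le.2 hN)
    rw [le_div_iff₀ (by linarith)] at h1
    rw [div_lt_iff₀ hc₁0] at h2
    linarith
  have hTR : (1 : ℝ) ≤ T := Nat.one_le_cast.2 (Nat.one_le_iff_ne_zero.2 hT)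
  suffices h : c₁ * √N₀ * Q ≤ c₃ * (S ^ ℓ * T) by
    rw [div_mul_eq_mul_div, div_le_iff₀ hc₃0]
    linarith
  rcases le_or_gt (T : ℝ) Q with hTQ | hTQ
  · have h1 : c₁ * √N₀ * Q ≤ (3 * ℓ : ℝ) ^ ℓ * (S * T) := by
      calc c₁ * √N₀ * Q ≤ (ℓ * (T + 2) : ℝ) ^ ℓ / N * Q := by gcongr
        _ ≤ (3 * ℓ * T : ℝ) ^ ℓ / N * Q := by
            gcongr ?_ ^ ℓ / N * Q
            nlinarith
        _ = (3 * ℓ : ℝ) ^ ℓ * (T * T ^ (ℓ - 1)) / N * Q := by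
            rw [mul_pow, mul_pow_sub_one hℓ.ne']
        _ ≤ (3 * ℓ : ℝ) ^ ℓ * (T * Q ^ (ℓ - 1)) / N * Q := by gcongr
        _ = (3 * ℓ : ℝ) ^ ℓ * T * (Q ^ (ℓ - 1) * Q) / N := by ring
        _ = (3 * ℓ : ℝ) ^ ℓ * (S * T) := by
            rw [pow_sub_one_mul hℓ.ne', hQℓ]
            field_simp
    refine h1.trans ?_
    gcongr
    rw [hc₃]
    linarith
  · obtain ⟨J, hJ, hJT⟩ := exists_segments hQ1 hTQ
    have hwQ : (⌈Q⌉₊ : ℝ) ≤ 2 * Q := by linarith [(Nat.ceil_lt_add_one hQ0.le).le]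
    have hQNS : Q ≤ N * S := hQℓ ▸ le_self_pow₀ hQ1 hℓ.ne'
    have hx : ((ℓ * ⌈Q⌉₊ : ℕ) : ℝ) ^ ℓ / N ≤ (2 * ℓ : ℝ) ^ ℓ * S := by
      rw [div_le_iff₀ (by positivity)]
      calc ((ℓ * ⌈Q⌉₊ : ℕ) : ℝ) ^ ℓ ≤ (ℓ * (2 * Q)) ^ ℓ := by push_cast; gcongr
        _ = (2 * ℓ : ℝ) ^ ℓ * Q ^ ℓ := by rw [← mul_pow]; ring
        _ = _ := by rw [hQℓ]; ring
    have hxr : (2 * ℓ : ℝ) ^ ℓ * S * Real.exp 2 ≤ (ρ * S : ℕ) := by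
      push_cast
      nlinarith
    have h1 : c₁ * √N₀ ≤ J * (ℓ.factorial * ((ρ * S : ℕ) : ℝ) ^ ℓ +
        2 ^ S * (⌈Q⌉₊ * (ℓ * N * Real.exp (-(ρ * S : ℕ))))) :=
      le_of_le_successProbability D A hp (by positivity)
        (fun P y G => P.sum_card_usefulBefore_le_segments hℓ G y hJ (ρ * S) hx hxr) hA
    have h2 := two_pow_mul_exp_le (ℓ := ℓ) (w := ⌈Q⌉₊) hN1 ha haS hρ2 (by linarith)
    have h3 : c₁ * √N₀ ≤ 4 * T / Q * (c₂ * S ^ ℓ) := by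
      refine h1.trans ?_
      gcongr
      push_cast
      have h4 : 2 * (ℓ : ℝ) ≤ 2 * ℓ * (S : ℝ) ^ ℓ :=
        le_mul_of_one_le_right (by positivity) (hSR.trans hSℓ)
      have h5 : c₂ * (S : ℝ) ^ ℓ = ℓ.factorial * (ρ * S : ℝ) ^ ℓ + 2 * ℓ * (S : ℝ) ^ ℓ := by
        rw [hc₂, mul_pow]
        ring
      linarith
    have h4 : c₁ * √N₀ * Q ≤ 4 * c₂ * (S ^ ℓ * T) := by
      calc c₁ * √N₀ * Q ≤ 4 * T / Q * (c₂ * S ^ ℓ) * Q := by gcongr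
        _ = 4 * c₂ * (S ^ ℓ * T) := by field_simp
    refine h4.trans ?_
    gcongr
    rw [hc₃]
    linarith [pow_pos (by positivity : (0 : ℝ) < 3 * ℓ) ℓ]

end NestedCollision

theorem mainTheorem2 (ℓ : ℕ) (hℓ : 2 ≤ ℓ) (p a b : ℝ) (hp : 0 < p) (ha : 0 < a) (hb : 0 < b) :
    ∃ C : ℝ, 0 < C ∧ ∃ N₁ : ℕ, ∀ (N M N₀ S T : ℕ) [NeZero N] [NeZero N₀], N₁ ≤ N →
      a * Real.log N ≤ S →
      (S : ℝ) ≤ b * (N : ℝ) ^ (1 / ((ℓ : ℝ) ^ 2 - 1)) →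
      ∀ (D : PMF (ZMod N)) (A : NestedCollision.ClassicalAlgorithm ℓ M N N₀ S T),
        p ≤ NestedCollision.successProbability D A →
          C * ((N : ℝ) ^ (1 / (ℓ : ℝ)) * (N₀ : ℝ) ^ (1 / 2 : ℝ)) ≤
              (S : ℝ) ^ (((ℓ : ℝ) ^ 2 - 1) / ℓ) * T ∧
          C * ((N : ℝ) ^ (1 / (2 * (ℓ : ℝ))) * (N₀ : ℝ) ^ (1 / 2 : ℝ)) ≤
              (S : ℝ) ^ (((ℓ : ℝ) ^ 2 - 1) / (2 * ℓ)) * T := by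
  obtain ⟨c, hc, N₁, h⟩ := NestedCollision.exists_tradeoff ℓ (by omega) p a hp ha
  have hℓR : (2 : ℝ) ≤ ℓ := by exact_mod_cast hℓ
  have hℓ1 : (0 : ℝ) < (ℓ : ℝ) ^ 2 - 1 := by nlinarith
  set e : ℝ := ((ℓ : ℝ) ^ 2 - 1) / (2 * ℓ) with he
  have he0 : 0 < e := by positivity
  have hbe : 0 < b ^ e := Real.rpow_pos_of_pos hb e
  refine ⟨min c (c / b ^ e), lt_min hc (by positivity), max N₁ 2, ?_⟩
  intro N M N₀ S T _ _ hN haS hSb D A hA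
  have hN2 : (2 : ℝ) ≤ N := by exact_mod_cast (le_max_right N₁ 2).trans hN
  have hN0 : (0 : ℝ) < N := by linarith
  have hS0 : (0 : ℝ) < S := lt_of_lt_of_le (mul_pos ha (Real.log_pos (by linarith))) haS
  have hS1 : 1 ≤ S := Nat.cast_pos.1 hS0
  have hmain := h N M N₀ S T ((le_max_left N₁ 2).trans hN) hS1 haS D A hA
  rw [Real.sqrt_eq_rpow, Real.mul_rpow hN0.le hS0.le] at hmain
  set n₀ : ℝ := (N₀ : ℝ) ^ (1 / 2 : ℝ) with hn₀
  have hn₀0 : 0 ≤ n₀ := by positivity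
  have hexp : (S : ℝ) ^ (((ℓ : ℝ) ^ 2 - 1) / ℓ) * (S : ℝ) ^ (1 / (ℓ : ℝ)) = (S : ℝ) ^ ℓ := by
    rw [← Real.rpow_add hS0, ← Real.rpow_natCast (S : ℝ) ℓ]
    congr 1
    field_simp
    ring
  have hSpos : 0 < (S : ℝ) ^ (1 / (ℓ : ℝ)) := Real.rpow_pos_of_pos hS0 _
  have hfirst : c * ((N : ℝ) ^ (1 / (ℓ : ℝ)) * n₀) ≤ (S : ℝ) ^ (((ℓ : ℝ) ^ 2 - 1) / ℓ) * T := by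
    refine le_of_mul_le_mul_right ?_ hSpos
    calc _ = c * (n₀ * ((N : ℝ) ^ (1 / (ℓ : ℝ)) * (S : ℝ) ^ (1 / (ℓ : ℝ)))) := by ring
      _ ≤ (S : ℝ) ^ ℓ * T := hmain
      _ = _ := by rw [← hexp]; ring
  refine ⟨le_trans (by gcongr; exact min_le_left _ _) hfirst, ?_⟩
  -- The hypothesis `S ≤ b N ^ (1 / (ℓ ^ 2 - 1))` says that `S ^ e` is at most `b ^ e` times the
  -- square root of `N ^ (1 / ℓ)`.
  have hSe : (S : ℝ) ^ e ≤ b ^ e * (N : ℝ) ^ (1 / (2 * (ℓ : ℝ))) := by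
    refine (Real.rpow_le_rpow hS0.le hSb he0.le).trans_eq ?_
    rw [Real.mul_rpow hb.le (by positivity), ← Real.rpow_mul hN0.le]
    congr 2
    rw [he]
    field_simp
  have hS2 : (S : ℝ) ^ (((ℓ : ℝ) ^ 2 - 1) / ℓ) = (S : ℝ) ^ e * (S : ℝ) ^ e := by
    rw [← Real.rpow_add hS0]
    congr 1
    rw [he]
    field_simp
    ring
  have hNN : (N : ℝ) ^ (1 / (ℓ : ℝ)) =
      (N : ℝ) ^ (1 / (2 * (ℓ : ℝ))) * (N : ℝ) ^ (1 / (2 * (ℓ : ℝ))) := by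
    rw [← Real.rpow_add hN0]
    congr 1
    field_simp
    ring
  set ν : ℝ := (N : ℝ) ^ (1 / (2 * (ℓ : ℝ))) with hν
  have hν0 : 0 < ν := Real.rpow_pos_of_pos hN0 _
  have hsecond : c / b ^ e * (ν * n₀) ≤ (S : ℝ) ^ e * T := by
    rw [div_mul_eq_mul_div, div_le_iff₀ hbe]
    refine le_of_mul_le_mul_right ?_ hν0
    calc c * (ν * n₀) * ν = c * (ν * ν * n₀) := by ring
      _ ≤ (S : ℝ) ^ e * (S : ℝ) ^ e * T := by rw [← hNN, ← hS2]; exact hfirst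
      _ ≤ b ^ e * ν * (S : ℝ) ^ e * T := by gcongr
      _ = _ := by ring
  exact le_trans (by gcongr; exact min_le_right _ _) hsecond
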